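/- Let $\mathbb K=\mathbb R$ or $\mathbb C$, let $n\ge 0$ be an integer, $E$ a Banach space over $\mathbb K$ and $\mathfrak U$ an ultrafilter on a set $I$. The ultrapower $(E)_{\mathfrak U}$ is the Banach space of bounded families $(z_i)_{i\in I}$ in $E$, where two families are identified if $\lim_{i,\mathfrak U}\|z_i-y_i\|=0$, with the norm $\|(z_i)_{\mathfrak U}\|=\lim_{i,\mathfrak U}\|z_i\|$. Let $\mathcal P^n(E)$ be the space of continuous $n$-homogeneous polynomials $P:E\to\mathbb K$, that is $P(x)=A(x,\dots,x)$ with a (unique) continuous symmetric $n$-linear form $A$ on $E$. The iterated extension of $P$ to $(E)_{\mathfrak U}$ is $$\overline P\big((z_i)_{\mathfrak U}\big)=\lim_{i_1,\mathfrak U}\cdots\lim_{i_n,\mathfrak U}A(z_{i_1},\dots,z_{i_n}).$$ Let $\otimes^{n,s}E$ be the span of the tensors $\otimes^n x$ ($x\in E$) in $\otimes^n E$. An s-tensor norm $\alpha$ of order $n$ assigns to each Banach space $E$ a norm $\alpha(\cdot\,;\otimes^{n,s}E)$ on $\otimes^{n,s}E$ such that $\varepsilon_s\le\alpha\le\pi_s$,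 where $\varepsilon_s(z)=\sup\{|\langle\varphi^n,z\rangle|:\varphi\in E',\|\varphi\|\le1\}$ and $\pi_s(z)=\inf\{\sum_j|c_j|\|x_j\|^n: z=\sum_j c_j\otimes^n x_j\}$, and such that $\alpha((\otimes^{n,s}T)z;\otimes^{n,s}F)\le\|T\|^n\alpha(z;\otimes^{n,s}E)$ for all bounded operators $T:E\to F$ between Banach spaces and all $z\in\otimes^{n,s}E$. It is finitely generated if $\alpha(z;\otimes^{n,s}E)=\inf\{\alpha(z;\otimes^{n,s}M): M\subset E \text{ a finite dimensional subspace},\ z\in\otimes^{n,s}M\}$ for all $E$ and all $z\in\otimes^{n,s}E$. Let $\widetilde\otimes^{n,s}_\alpha E$ be the completion of $\otimes^{n,s}E$ under $\alpha$. A functional $\varphi\in(\widetilde\otimes^{n,s}_\alpha E)'$ is identified with the polynomial $P(x)=\varphi(\otimes^n x)$, and the norm of $P$ in $(\widetilde\otimes^{n,s}_\alpha E)'$ is $\|\varphi\|$. A Banach ideal of $n$-homogeneous polynomials $(\mathcal Q,\|\cdot\|_{\mathcal Q})$ assigns to each Banach space $E$ a linear subspace $\mathcal Q(E)\subset\mathcal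 P^n(E)$ with a complete norm $\|\cdot\|_{\mathcal Q(E)}$ such that (i) $P\circ T\in\mathcal Q(E_1)$ and $\|P\circ T\|_{\mathcal Q(E_1)}\le\|P\|_{\mathcal Q(E)}\|T\|^n$ for all $P\in\mathcal Q(E)$ and all bounded operators $T:E_1\to E$, and (ii) the polynomial $z\mapsto z^n$ belongs to $\mathcal Q(\mathbb K)$ and has norm $1$. It is maximal if for each Banach space $E$ a polynomial $P\in\mathcal P^n(E)$ belongs to $\mathcal Q(E)$ exactly when $\sup_M\|P|_M\|_{\mathcal Q(M)}<\infty$, where $M$ runs over the finite dimensional subspaces of $E$, and $\|P\|_{\mathcal Q(E)}$ is then equal to this supremum. **Theorem.** (a) If $\alpha$ is a finitely generated s-tensor norm of order $n$ and $P\in(\widetilde\otimes^{n,s}_\alpha E)'$, then $\overline P\in(\widetilde\otimes^{n,s}_\alpha(E)_{\mathfrak U})'$ and $$\|P\|_{(\widetilde\otimes^{n,s}_\alpha E)'}=\|\overline P\|_{(\widetilde\otimes^{n,s}_\alpha(E)_{\mathfrak U})'}.$$ (b) If $\mathcal Q$ is a maximal Banach ideal of $n$-homogeneous polynomials and $P\in\mathcal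 Q(E)$, then $\overline P\in\mathcal Q((E)_{\mathfrak U})$ and $$\|P\|_{\mathcal Q(E)}=\|\overline P\|_{\mathcal Q((E)_{\mathfrak U})}.$$ -/

import Mathlib

open Filter Topology
open scoped ENNReal TensorProduct

universe u

noncomputable section

namespace PolyExt

/-! ### Continuous homogeneous polynomials -/

section Polynomials

variable (𝕜 : Type) [RCLike 𝕜] (n : ℕ)
variable (E : Type u) [NormedAddCommGroup E] [NormedSpace 𝕜 E]

/-- The space of continuous scalar valued `n`-homogeneous polynomials on `E`: the diagonals
`x ↦ A (x, …, x)` of continuous symmetric `n`-linear forms `A`. -/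
def HomPoly : Submodule 𝕜 (E → 𝕜) where
  carrier := {P | ∃ A : ContinuousMultilinearMap 𝕜 (fun _ : Fin n => E) 𝕜,
    (∀ (σ : Equiv.Perm (Fin n)) (v : Fin n → E), A (v ∘ σ) = A v) ∧
      ∀ x, P x = A (fun _ => x)}
  add_mem' := by
    rintro P Q ⟨A, hA, hP⟩ ⟨B, hB, hQ⟩
    exact ⟨A + B, fun σ v => by simp [hA σ v, hB σ v], fun x => by simp [hP x, hQ x]⟩
  zero_mem' := ⟨0, fun _ _ => by simp, fun _ => by simp⟩
  smul_mem' := by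
    rintro c P ⟨A, hA, hP⟩
    exact ⟨c • A, fun σ v => by simp [hA σ v], fun x => by simp [hP x]⟩

variable {𝕜 n E}

/-- The symmetric continuous `n`-linear form associated with a polynomial (it is unique, by the
polarization formula). -/
def HomPoly.assoc (P : HomPoly 𝕜 n E) : ContinuousMultilinearMap 𝕜 (fun _ : Fin n => E) 𝕜 :=
  P.2.choose

theorem HomPoly.assoc_symm (P : HomPoly 𝕜 n E) (σ : Equiv.Perm (Fin n)) (v : Fin n → E) :
    HomPoly.assoc P (v ∘ σ) = HomPoly.assoc P v :=
  P.2.choose_spec.1 σ v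

theorem HomPoly.assoc_diag (P : HomPoly 𝕜 n E) (x : E) : P.1 x = HomPoly.assoc P (fun _ => x) :=
  P.2.choose_spec.2 x

end Polynomials

/-! ### Ultrapowers -/

section Ultrapower

variable (𝕜 : Type) [RCLike 𝕜] {I : Type u} (U : Ultrafilter I)
variable (E : Type u) [NormedAddCommGroup E] [NormedSpace 𝕜 E]

/-- The bounded families `(z_i)` in `E` with `lim_{i, U} ‖z_i‖ = 0`. -/
def nullFamilies : Submodule 𝕜 (lp (fun _ : I => E) ∞) where
  carrier := {z | Tendsto (fun i => ‖z i‖) U (𝓝 0)}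
  add_mem' := by
    intro a b ha hb
    refine squeeze_zero (fun _ => norm_nonneg _) (fun i => norm_add_le (a i) (b i)) ?_
    simpa using ha.add hb
  zero_mem' := by simp
  smul_mem' := by
    intro c a ha
    simpa [norm_smul] using ha.const_mul ‖c‖

instance isClosed_nullFamilies :
    IsClosed ((nullFamilies 𝕜 U E : Submodule 𝕜 (lp (fun _ : I => E) ∞)) :
      Set (lp (fun _ : I => E) ∞)) := by
  rw [← isSeqClosed_iff_isClosed]
  intro a z ha hz
  change Tendsto (fun i => ‖z i‖) U (𝓝 0)
  rw [Metric.tendsto_nhds]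
  intro ε hε
  obtain ⟨k, hk⟩ := (Metric.tendsto_atTop.1 hz (ε / 2) (half_pos hε))
  have h1 := hk k le_rfl
  have h2 : Tendsto (fun i => ‖a k i‖) U (𝓝 0) := ha k
  filter_upwards [(Metric.tendsto_nhds.1 h2) (ε / 2) (half_pos hε)] with i hi
  have h3 : ‖(z - a k) i‖ ≤ ‖z - a k‖ := lp.norm_apply_le_norm (by simp) _ i
  have h4 : ‖z i‖ ≤ ‖(z - a k) i‖ + ‖a k i‖ := by
    simpa using norm_add_le ((z - a k) i) (a k i)
  rw [dist_comm, dist_eq_norm] at h1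
  simp only [dist_zero_right, norm_norm] at hi ⊢
  linarith

/-- The ultrapower `(E)_U`: bounded families modulo the families that tend to `0` along `U`.
Its norm, the quotient norm of `ℓ^∞(I, E)`, is `lim_{i, U} ‖z_i‖`, see `Ultrapower.tendsto_norm`. -/
def Ultrapower : Type u := lp (fun _ : I => E) ∞ ⧸ nullFamilies 𝕜 U E

instance : NormedAddCommGroup (Ultrapower 𝕜 U E) :=
  inferInstanceAs (NormedAddCommGroup (lp (fun _ : I => E) ∞ ⧸ nullFamilies 𝕜 U E))

instance : NormedSpace 𝕜 (Ultrapower 𝕜 U E) :=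
  inferInstanceAs (NormedSpace 𝕜 (lp (fun _ : I => E) ∞ ⧸ nullFamilies 𝕜 U E))

instance [CompleteSpace E] : CompleteSpace (Ultrapower 𝕜 U E) :=
  inferInstanceAs (CompleteSpace (lp (fun _ : I => E) ∞ ⧸ nullFamilies 𝕜 U E))

variable {E}

/-- The class `(z_i)_U` of a bounded family. -/
def Ultrapower.mk : lp (fun _ : I => E) ∞ →ₗ[𝕜] Ultrapower 𝕜 U E := (nullFamilies 𝕜 U E).mkQ

variable {𝕜 U}

theorem Ultrapower.mk_surjective :
    Function.Surjective (Ultrapower.mk 𝕜 U : lp (fun _ : I => E) ∞ →ₗ[𝕜] Ultrapower 𝕜 U E) :=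
  (nullFamilies 𝕜 U E).mkQ_surjective

theorem Ultrapower.mk_eq_mk_iff (z y : lp (fun _ : I => E) ∞) :
    Ultrapower.mk 𝕜 U z = Ultrapower.mk 𝕜 U y ↔ Tendsto (fun i => ‖z i - y i‖) U (𝓝 0) :=
  Submodule.Quotient.eq _

/-- A chosen representing family of an element of the ultrapower. -/
def Ultrapower.rep (z : Ultrapower 𝕜 U E) : lp (fun _ : I => E) ∞ :=
  Function.surjInv Ultrapower.mk_surjective z

theorem Ultrapower.mk_rep (z : Ultrapower 𝕜 U E) : Ultrapower.mk 𝕜 U z.rep = z :=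
  Function.surjInv_eq _ z

/-- The norm of the ultrapower is `‖(z_i)_U‖ = lim_{i, U} ‖z_i‖`. -/
theorem Ultrapower.tendsto_norm (z : lp (fun _ : I => E) ∞) :
    Tendsto (fun i => ‖z i‖) U (𝓝 ‖Ultrapower.mk 𝕜 U z‖) := by
  classical
  obtain ⟨L, -, hL⟩ := (isCompact_Icc (a := (0 : ℝ)) (b := ‖z‖)).ultrafilter_le_nhds
    (U.map fun i => ‖z i‖) (by
      rw [le_principal_iff]
      exact Filter.mem_map.2 (Filter.univ_mem' fun i =>
        ⟨norm_nonneg _, lp.norm_apply_le_norm (by simp) z i⟩))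
  replace hL : Tendsto (fun i => ‖z i‖) U (𝓝 L) := hL
  have hL0 : 0 ≤ L := ge_of_tendsto' hL fun _ => norm_nonneg _
  suffices h : ‖Ultrapower.mk 𝕜 U z‖ = L by rwa [h]
  apply le_antisymm
  · refine le_of_forall_pos_le_add fun ε hε => ?_
    have hS : ∀ᶠ i in (U : Filter I), ‖z i‖ < L + ε := hL.eventually_lt_const (by linarith)
    let w : I → E := fun i => if ‖z i‖ < L + ε then z i else 0
    have hw : ∀ i, ‖w i‖ ≤ L + ε := by
      intro i
      by_cases h : ‖z i‖ < L + ε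
      · simp only [w, if_pos h]; exact h.le
      · simp only [w, if_neg h, norm_zero]; linarith
    let w' : lp (fun _ : I => E) ∞ :=
      ⟨w, memℓp_infty ⟨L + ε, by rintro _ ⟨i, rfl⟩; exact hw i⟩⟩
    have h1 : Ultrapower.mk 𝕜 U z = Ultrapower.mk 𝕜 U w' := by
      rw [Ultrapower.mk_eq_mk_iff]
      refine tendsto_const_nhds.congr' ?_
      filter_upwards [hS] with i hi
      simp [w', w, hi]
    rw [h1]
    exact (Submodule.Quotient.norm_mk_le _ _).trans
      (lp.norm_le_of_forall_le (by linarith) hw)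
  · refine le_of_forall_pos_le_add fun ε hε => ?_
    obtain ⟨w, hw, hwn⟩ : ∃ w, Ultrapower.mk 𝕜 U w = Ultrapower.mk 𝕜 U z ∧
        ‖w‖ < ‖Ultrapower.mk 𝕜 U z‖ + ε :=
      Submodule.Quotient.norm_mk_lt (S := nullFamilies 𝕜 U E) (Ultrapower.mk 𝕜 U z) hε
    have h1 : Tendsto (fun i => ‖z i - w i‖) U (𝓝 0) :=
      (Ultrapower.mk_eq_mk_iff z w).1 hw.symm
    have h2 : Tendsto (fun i => ‖z i‖ - ‖z i - w i‖) U (𝓝 (L - 0)) := hL.sub h1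
    rw [sub_zero] at h2
    refine (le_of_tendsto' h2 fun i => ?_).trans hwn.le
    have h3 : ‖w i‖ ≤ ‖w‖ := lp.norm_apply_le_norm (by simp) w i
    have h4 := norm_sub_norm_le (z i) (w i)
    linarith [norm_sub_norm_le (z i) (z i - w i), norm_sub_le (z i) (z i - w i),
      show ‖z i‖ ≤ ‖z i - w i‖ + ‖w i‖ by simpa using norm_add_le (z i - w i) (w i)]

end Ultrapower

/-! ### Iterated limits and the iterated extension -/

section Iterated

variable {𝕜 : Type} [RCLike 𝕜] {I : Type u} (U : Ultrafilter I)

/-- The iterated limit `lim_{i₁, U} ⋯ lim_{iₙ, U} f (i₁, …, iₙ)`. -/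
def iterLim : (n : ℕ) → ((Fin n → I) → 𝕜) → 𝕜
  | 0, f => f Fin.elim0
  | n + 1, f => limUnder (U : Filter I) fun i => iterLim n fun k => f (Fin.cons i k)

theorem tendsto_limUnder_of_bounded (g : I → 𝕜) (C : ℝ) (hg : ∀ i, ‖g i‖ ≤ C) :
    Tendsto g U (𝓝 (limUnder (U : Filter I) g)) := by
  obtain ⟨L, -, hL⟩ := (isCompact_closedBall (0 : 𝕜) C).ultrafilter_le_nhds (U.map g) (by
    rw [le_principal_iff]
    exact Filter.mem_map.2 (Filter.univ_mem' fun i => by simpa using hg i))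
  exact tendsto_nhds_limUnder ⟨L, hL⟩

theorem norm_iterLim_le (n : ℕ) (f : (Fin n → I) → 𝕜) (C : ℝ) (hf : ∀ k, ‖f k‖ ≤ C) :
    ‖iterLim U n f‖ ≤ C := by
  induction n with
  | zero => exact hf _
  | succ n ih =>
    have h : ∀ i, ‖iterLim U n fun k => f (Fin.cons i k)‖ ≤ C := fun i => ih _ fun k => hf _
    exact le_of_tendsto' (tendsto_limUnder_of_bounded U _ C h).norm h

/-- For a bounded family all the limits in `iterLim` exist. -/
theorem tendsto_iterLim (n : ℕ) (f : (Fin (n + 1) → I) → 𝕜) (C : ℝ) (hf : ∀ k, ‖f k‖ ≤ C) :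
    Tendsto (fun i => iterLim U n fun k => f (Fin.cons i k)) U (𝓝 (iterLim U (n + 1) f)) :=
  tendsto_limUnder_of_bounded U _ C fun _ => norm_iterLim_le U n _ C fun _ => hf _

theorem norm_iterLim_sub_le (n : ℕ) (f g : (Fin n → I) → 𝕜) (C c : ℝ) (d : Fin n → I → ℝ)
    (hf : ∀ k, ‖f k‖ ≤ C) (hg : ∀ k, ‖g k‖ ≤ C) (hd : ∀ j, Tendsto (d j) U (𝓝 0))
    (hfg : ∀ k, ‖f k - g k‖ ≤ c + ∑ j, d j (k j)) :
    ‖iterLim U n f - iterLim U n g‖ ≤ c := by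
  induction n generalizing c with
  | zero => simpa [iterLim] using hfg Fin.elim0
  | succ n ih =>
    have h1 := ((tendsto_iterLim U n f C hf).sub (tendsto_iterLim U n g C hg)).norm
    have h2 : Tendsto (fun i => c + d 0 i) U (𝓝 (c + 0)) := (hd 0).const_add c
    rw [add_zero] at h2
    refine le_of_tendsto_of_tendsto' h1 h2 fun i => ?_
    refine ih _ _ (c + d 0 i) (fun j => d j.succ) (fun _ => hf _) (fun _ => hg _)
      (fun j => hd j.succ) fun k => ?_
    have := hfg (Fin.cons i k)
    rw [Fin.sum_univ_succ] at this
    simpa [add_assoc] using this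

variable {U} {n : ℕ} {E : Type u} [NormedAddCommGroup E] [NormedSpace 𝕜 E]

/-- The iterated extension of a continuous `n`-linear form to the ultrapower,
`(z₁, …, zₙ) ↦ lim_{i₁, U} ⋯ lim_{iₙ, U} A (z_{i₁}^{(1)}, …, z_{iₙ}^{(n)})`. The value does not
depend on the representing families, see `iterExtMultilinear_mk`. -/
def iterExtMultilinear (A : ContinuousMultilinearMap 𝕜 (fun _ : Fin n => E) 𝕜)
    (z : Fin n → Ultrapower 𝕜 U E) : 𝕜 :=
  iterLim U n fun i => A fun j => (z j).rep (i j)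

theorem iterExtMultilinear_mk (A : ContinuousMultilinearMap 𝕜 (fun _ : Fin n => E) 𝕜)
    (w : Fin n → lp (fun _ : I => E) ∞) :
    iterExtMultilinear A (fun j => Ultrapower.mk 𝕜 U (w j)) =
      iterLim U n fun i => A fun j => w j (i j) := by
  set v : Fin n → lp (fun _ : I => E) ∞ := fun j => (Ultrapower.mk 𝕜 U (w j)).rep with hv
  set B : ℝ := max ‖v‖ ‖w‖ with hB
  have hb : ∀ (a : Fin n → lp (fun _ : I => E) ∞) (i : Fin n → I),
      ‖fun j => a j (i j)‖ ≤ ‖a‖ := fun a i =>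
    (pi_norm_le_iff_of_nonneg (norm_nonneg _)).2 fun j =>
      (lp.norm_apply_le_norm (by simp) (a j) (i j)).trans (norm_le_pi_norm a j)
  have hbound : ∀ (a : Fin n → lp (fun _ : I => E) ∞), ‖a‖ ≤ B → ∀ i : Fin n → I,
      ‖A fun j => a j (i j)‖ ≤ ‖A‖ * B ^ n := by
    intro a ha i
    simpa using A.le_opNorm_mul_pow_of_le ((hb a i).trans ha)
  have hd : ∀ j, Tendsto (fun i => ‖v j i - w j i‖) U (𝓝 0) := fun j =>
    (Ultrapower.mk_eq_mk_iff (𝕜 := 𝕜) (v j) (w j)).1 (Ultrapower.mk_rep _)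
  have key := norm_iterLim_sub_le U n (fun i => A fun j => v j (i j))
    (fun i => A fun j => w j (i j)) (‖A‖ * B ^ n) 0
    (fun j i => ‖A‖ * n * B ^ (n - 1) * ‖v j i - w j i‖)
    (hbound v (le_max_left _ _)) (hbound w (le_max_right _ _))
    (fun j => by simpa using (hd j).const_mul (‖A‖ * n * B ^ (n - 1))) (fun i => by
      have h1 := A.norm_image_sub_le (fun j => v j (i j)) (fun j => w j (i j))
      rw [Fintype.card_fin] at h1
      rw [zero_add, ← Finset.mul_sum]
      refine h1.trans ?_
      have hB0 : 0 ≤ B := (norm_nonneg v).trans (le_max_left _ _)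
      have h2 : max ‖fun j => v j (i j)‖ ‖fun j => w j (i j)‖ ≤ B :=
        max_le_max (hb v i) (hb w i)
      have h3 : ‖(fun j => v j (i j)) - fun j => w j (i j)‖ ≤ ∑ j, ‖v j (i j) - w j (i j)‖ :=
        (pi_norm_le_iff_of_nonneg (Finset.sum_nonneg fun _ _ => norm_nonneg _)).2 fun j =>
          Finset.single_le_sum (f := fun j => ‖v j (i j) - w j (i j)‖)
            (fun _ _ => norm_nonneg _) (Finset.mem_univ j)
      gcongr)
  exact sub_eq_zero.1 (norm_le_zero_iff.1 key)

/-- The iterated extension `P̄` of a continuous homogeneous polynomial to the ultrapower. -/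
def iterExt (U : Ultrafilter I) (P : HomPoly 𝕜 n E) : Ultrapower 𝕜 U E → 𝕜 :=
  fun z => iterExtMultilinear (HomPoly.assoc P) fun _ => z

end Iterated

/-! ### Symmetric tensor products and s-tensor norms -/

section Tensor

variable (𝕜 : Type) [RCLike 𝕜] (n : ℕ)

section Space

variable (E : Type u) [NormedAddCommGroup E] [NormedSpace 𝕜 E]

/-- The `n`-fold symmetric tensor product `⊗^{n,s} E`: the span of the powers `⊗ⁿ x` in `⊗ⁿ E`. -/
def SymTensor : Submodule 𝕜 (⨂[𝕜] _ : Fin n, E) :=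
  Submodule.span 𝕜 (Set.range fun x : E => PiTensorProduct.tprod 𝕜 fun _ : Fin n => x)

variable {E}

/-- The power `⊗ⁿ x`. -/
def symPow (x : E) : SymTensor 𝕜 n E :=
  ⟨PiTensorProduct.tprod 𝕜 fun _ : Fin n => x, Submodule.subset_span ⟨x, rfl⟩⟩

variable {𝕜 n}

/-- The induced map `⊗^{n,s} T : ⊗^{n,s} E → ⊗^{n,s} F`. -/
def SymTensor.map {F : Type u} [NormedAddCommGroup F] [NormedSpace 𝕜 F] (T : E →L[𝕜] F) :
    SymTensor 𝕜 n E →ₗ[𝕜] SymTensor 𝕜 n F :=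
  (PiTensorProduct.map fun _ : Fin n => (T : E →ₗ[𝕜] F)).restrict (by
    intro z hz
    induction hz using Submodule.span_induction with
    | mem z hz =>
      obtain ⟨x, rfl⟩ := hz
      rw [PiTensorProduct.map_tprod]
      exact (symPow 𝕜 n (T x)).2
    | zero => simp
    | add a b _ _ ha hb => rw [map_add]; exact add_mem ha hb
    | smul c a _ ha => rw [map_smul]; exact Submodule.smul_mem _ c ha)

/-- The value `⟨φⁿ, z⟩` of the linear functional with `⊗ⁿ x ↦ φ(x)ⁿ`. -/
def powPairing (φ : StrongDual 𝕜 E) (z : SymTensor 𝕜 n E) : 𝕜 :=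
  PiTensorProduct.lift ((MultilinearMap.mkPiAlgebra 𝕜 (Fin n) 𝕜).compLinearMap
    fun _ : Fin n => (φ : E →ₗ[𝕜] 𝕜)) z.1

/-- The injective s-tensor norm `ε_s (z) = sup {|⟨φⁿ, z⟩| : ‖φ‖ ≤ 1}`. -/
def epsNorm (z : SymTensor 𝕜 n E) : ℝ :=
  sSup {r | ∃ φ : StrongDual 𝕜 E, ‖φ‖ ≤ 1 ∧ r = ‖powPairing φ z‖}

/-- The projective s-tensor norm
`π_s (z) = inf {∑ |c_j| ‖x_j‖ⁿ : z = ∑ c_j ⊗ⁿ x_j}`. -/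
def piNorm (z : SymTensor 𝕜 n E) : ℝ :=
  sInf {r | ∃ (m : ℕ) (c : Fin m → 𝕜) (x : Fin m → E),
    z = ∑ j, c j • symPow 𝕜 n (x j) ∧ r = ∑ j, ‖c j‖ * ‖x j‖ ^ n}

end Space

/-- An s-tensor norm of order `n`: a norm on `⊗^{n,s} E` for each Banach space `E`, with
`ε_s ≤ α ≤ π_s` and the metric mapping property. -/
structure STensorNorm where
  /-- the norm `α(·; ⊗^{n,s} E)` -/
  nrm : ∀ (E : Type u) [NormedAddCommGroup E] [NormedSpace 𝕜 E] [CompleteSpace E],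
    Seminorm 𝕜 (SymTensor 𝕜 n E)
  eq_zero : ∀ (E : Type u) [NormedAddCommGroup E] [NormedSpace 𝕜 E] [CompleteSpace E]
    (z : SymTensor 𝕜 n E), nrm E z = 0 → z = 0
  eps_le : ∀ (E : Type u) [NormedAddCommGroup E] [NormedSpace 𝕜 E] [CompleteSpace E]
    (z : SymTensor 𝕜 n E), epsNorm z ≤ nrm E z
  le_pi : ∀ (E : Type u) [NormedAddCommGroup E] [NormedSpace 𝕜 E] [CompleteSpace E]
    (z : SymTensor 𝕜 n E), nrm E z ≤ piNorm z
  map_le : ∀ (E F : Type u) [NormedAddCommGroup E] [NormedSpace 𝕜 E] [CompleteSpace E]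
    [NormedAddCommGroup F] [NormedSpace 𝕜 F] [CompleteSpace F] (T : E →L[𝕜] F)
    (z : SymTensor 𝕜 n E), nrm F (SymTensor.map T z) ≤ ‖T‖ ^ n * nrm E z

namespace STensorNorm

variable {𝕜 n} (α : STensorNorm.{u} 𝕜 n)

/-- `α(z; ⊗^{n,s} E)` is the infimum of the `α(z; ⊗^{n,s} M)` over the finite dimensional
subspaces `M` of `E` with `z ∈ ⊗^{n,s} M`. -/
def IsFinitelyGenerated : Prop :=
  ∀ (E : Type u) [NormedAddCommGroup E] [NormedSpace 𝕜 E] [CompleteSpace E]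
    (z : SymTensor 𝕜 n E),
    IsGLB {r | ∃ (M : Submodule 𝕜 E) (_ : FiniteDimensional 𝕜 M) (w : SymTensor 𝕜 n M),
      SymTensor.map M.subtypeL w = z ∧ r = α.nrm M w} (α.nrm E z)

variable (E : Type u) [NormedAddCommGroup E] [NormedSpace 𝕜 E] [CompleteSpace E]

/-- The normed space `⊗_α^{n,s} E`. -/
def Space (_α : STensorNorm.{u} 𝕜 n) (E : Type u) [NormedAddCommGroup E] [NormedSpace 𝕜 E]
    [CompleteSpace E] : Type u :=
  SymTensor 𝕜 n E

instance : AddCommGroup (α.Space E) := inferInstanceAs (AddCommGroup (SymTensor 𝕜 n E))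

instance : Module 𝕜 (α.Space E) := inferInstanceAs (Module 𝕜 (SymTensor 𝕜 n E))

instance : NormedAddCommGroup (α.Space E) :=
  AddGroupNorm.toNormedAddCommGroup
    { toFun := fun z : SymTensor 𝕜 n E => α.nrm E z
      map_zero' := map_zero (α.nrm E)
      add_le' := map_add_le_add (α.nrm E)
      neg' := map_neg_eq_map (α.nrm E)
      eq_zero_of_map_eq_zero' := α.eq_zero E }

instance : NormedSpace 𝕜 (α.Space E) where
  norm_smul_le c z := (map_smul_eq_mul (α.nrm E) c z).le

/-- The Banach space `⊗̃_α^{n,s} E`, the completion of `⊗_α^{n,s} E`. -/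
abbrev Compl : Type u := UniformSpace.Completion (α.Space E)

variable {E}

/-- A symmetric tensor as an element of the normed space `⊗_α^{n,s} E`. -/
def toSpace : SymTensor 𝕜 n E →ₗ[𝕜] α.Space E := LinearMap.id

theorem norm_toSpace (z : SymTensor 𝕜 n E) : ‖α.toSpace z‖ = α.nrm E z := rfl

/-- The power `⊗ⁿ x` as an element of `⊗̃_α^{n,s} E`. -/
def pow (x : E) : α.Compl E := (α.toSpace (symPow 𝕜 n x) : α.Space E)

/-- The functional `φ ∈ (⊗̃_α^{n,s} E)'` is (the linearization of) the polynomial `P`. Such a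
`φ` is unique, since the powers span a dense subspace. -/
def Represents (φ : StrongDual 𝕜 (α.Compl E)) (P : E → 𝕜) : Prop :=
  ∀ x : E, φ (α.pow x) = P x

end STensorNorm

end Tensor

/-! ### Banach ideals of homogeneous polynomials -/

/-- A Banach ideal of continuous scalar valued `n`-homogeneous polynomials. -/
structure PolyIdeal (𝕜 : Type) [RCLike 𝕜] (n : ℕ) where
  /-- the component `𝒬(E)` -/
  carrier : ∀ (E : Type u) [NormedAddCommGroup E] [NormedSpace 𝕜 E] [CompleteSpace E],
    Submodule 𝕜 (E → 𝕜)
  le_homPoly : ∀ (E : Type u) [NormedAddCommGroup E] [NormedSpace 𝕜 E] [CompleteSpace E],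
    carrier E ≤ HomPoly 𝕜 n E
  /-- the norm `‖·‖_{𝒬(E)}` -/
  nrm : ∀ (E : Type u) [NormedAddCommGroup E] [NormedSpace 𝕜 E] [CompleteSpace E],
    Seminorm 𝕜 (carrier E)
  eq_zero : ∀ (E : Type u) [NormedAddCommGroup E] [NormedSpace 𝕜 E] [CompleteSpace E]
    (P : carrier E), nrm E P = 0 → P = 0
  /-- `𝒬(E)` is complete: Cauchy sequences converge -/
  complete : ∀ (E : Type u) [NormedAddCommGroup E] [NormedSpace 𝕜 E] [CompleteSpace E]
    (p : ℕ → carrier E),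
    (∀ ε : ℝ, 0 < ε → ∃ N, ∀ k ≥ N, ∀ l ≥ N, nrm E (p k - p l) < ε) →
      ∃ P : carrier E, Tendsto (fun k => nrm E (p k - P)) atTop (𝓝 0)
  comp_mem : ∀ (E₁ E : Type u) [NormedAddCommGroup E₁] [NormedSpace 𝕜 E₁] [CompleteSpace E₁]
    [NormedAddCommGroup E] [NormedSpace 𝕜 E] [CompleteSpace E] (T : E₁ →L[𝕜] E)
    (P : E → 𝕜), P ∈ carrier E → P ∘ T ∈ carrier E₁
  nrm_comp_le : ∀ (E₁ E : Type u) [NormedAddCommGroup E₁] [NormedSpace 𝕜 E₁] [CompleteSpace E₁]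
    [NormedAddCommGroup E] [NormedSpace 𝕜 E] [CompleteSpace E] (T : E₁ →L[𝕜] E)
    (P : E → 𝕜) (hP : P ∈ carrier E),
    nrm E₁ ⟨P ∘ T, comp_mem E₁ E T P hP⟩ ≤ nrm E ⟨P, hP⟩ * ‖T‖ ^ n
  /-- the polynomial `z ↦ zⁿ` on the scalar field (lifted to the universe of the spaces) -/
  pow_mem : (fun z : ULift.{u} 𝕜 => z.down ^ n) ∈ carrier (ULift.{u} 𝕜)
  nrm_pow : nrm (ULift.{u} 𝕜) ⟨fun z : ULift.{u} 𝕜 => z.down ^ n, pow_mem⟩ = 1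

namespace PolyIdeal

variable {𝕜 : Type} [RCLike 𝕜] {n : ℕ} (Q : PolyIdeal.{u} 𝕜 n)
variable {E : Type u} [NormedAddCommGroup E] [NormedSpace 𝕜 E] [CompleteSpace E]

open Classical in
/-- The ideal norm with value `∞` outside of `𝒬(E)`. -/
def extNrm (P : E → 𝕜) : ℝ≥0∞ :=
  if h : P ∈ Q.carrier E then ENNReal.ofReal (Q.nrm E ⟨P, h⟩) else ⊤

/-- `‖P‖_{𝒬^max(E)} = sup {‖P|_M‖_{𝒬(M)} : M ∈ FIN(E)} ∈ [0, ∞]`. -/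
def maxNrm (P : E → 𝕜) : ℝ≥0∞ :=
  ⨆ (M : Submodule 𝕜 E) (_ : FiniteDimensional 𝕜 M), Q.extNrm (P ∘ M.subtypeL)

/-- The ideal coincides with its maximal kernel, with equal norms. -/
def IsMaximal : Prop :=
  ∀ (E : Type u) [NormedAddCommGroup E] [NormedSpace 𝕜 E] [CompleteSpace E],
    ∀ P ∈ HomPoly 𝕜 n E, (P ∈ Q.carrier E ↔ Q.maxNrm P < ⊤) ∧
      ∀ hP : P ∈ Q.carrier E, ENNReal.ofReal (Q.nrm E ⟨P, hP⟩) = Q.maxNrm P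

end PolyIdeal

end PolyExt

end

/-!
Let `T i : M → E` be the coordinates of a linear lifting of a finite dimensional `M ⊆ (E)_U` to
bounded families; `‖T i‖ ≤ r` for `U`-almost all `i` if `r > 1`. Put
`S = (T i₁ + ⋯ + T iₘ) / m`, expand `P (S x)` by multilinearity and take the iterated limit over
`i₁, …, iₘ`: of the `mⁿ` terms, those with distinct indices tend to `P̄ x`, because `A` is
symmetric, and the proportion of the others, which are bounded, vanishes as `m → ∞`. Hence `P̄` is
on `M` a pointwise limit of polynomials `P ∘ S` with `‖S‖ ≤ r`. Finitely generated norms and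
maximal ideals see only finite dimensional subspaces, which gives `‖P̄‖ ≤ ‖P‖`; conversely `P` is
the composition of `P̄` with the canonical embedding `E → (E)_U`.
-/

noncomputable section

namespace PolyExt

section IteratedUltrafilter

variable {𝕜 : Type} [RCLike 𝕜] {I : Type u} (U : Ultrafilter I)

/-- The `n`-fold iterated product of the ultrafilter `U`, the ultrafilter on `Iⁿ` with
`∀ᶠ (i₁, …, iₙ), p (i₁, …, iₙ)` iff `∀ᶠ i₁ in U, …, ∀ᶠ iₙ in U, p (i₁, …, iₙ)`. It turns iterated
limits into ordinary ones. -/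
def iterUltrafilter : (n : ℕ) → Ultrafilter (Fin n → I)
  | 0 => pure Fin.elim0
  | n + 1 => U.bind fun i => (iterUltrafilter n).map (Fin.cons i)

theorem eventually_iterUltrafilter_succ {n : ℕ} {p : (Fin (n + 1) → I) → Prop} :
    (∀ᶠ k in iterUltrafilter U (n + 1), p k) ↔
      ∀ᶠ i in U, ∀ᶠ k in iterUltrafilter U n, p (Fin.cons i k) :=
  Iff.rfl

theorem tendsto_apply_iterUltrafilter {n : ℕ} (j : Fin n) :
    Tendsto (fun k : Fin n → I => k j) (iterUltrafilter U n) U := by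
  induction n with
  | zero => exact j.elim0
  | succ n ih =>
    refine fun s hs => (eventually_iterUltrafilter_succ U).2 ?_
    cases j using Fin.cases with
    | zero => filter_upwards [hs] with i hi using Eventually.of_forall fun _ => hi
    | succ j => exact Eventually.of_forall fun _ => ih j hs

theorem exists_strictMono_succ_comp_eq {m n : ℕ} {s : Fin n → Fin (m + 1)} (hs : StrictMono s)
    (h0 : ∀ j, s j ≠ 0) : ∃ t : Fin n → Fin m, StrictMono t ∧ Fin.succ ∘ t = s := by
  choose t ht using fun j => Fin.exists_succ_eq.2 (h0 j)
  obtain rfl : Fin.succ ∘ t = s := funext ht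
  exact ⟨t, fun _ _ hab => Fin.succ_lt_succ_iff.1 (hs hab), rfl⟩

theorem tendsto_comp_iterUltrafilter {m n : ℕ} {s : Fin n → Fin m} (hs : StrictMono s) :
    Tendsto (fun k : Fin m → I => k ∘ s) (iterUltrafilter U m) (iterUltrafilter U n) := by
  induction m generalizing n with
  | zero =>
    obtain rfl : n = 0 := Nat.eq_zero_of_not_pos fun h => (s ⟨0, h⟩).elim0
    exact tendsto_pure.2 (Eventually.of_forall fun _ => Subsingleton.elim _ _)
  | succ m ih =>
    intro p hp
    refine (eventually_iterUltrafilter_succ U).2 ?_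
    by_cases h0 : ∀ j, s j ≠ 0
    · obtain ⟨t, ht, rfl⟩ := exists_strictMono_succ_comp_eq hs h0
      exact Eventually.of_forall fun _ => ih ht hp
    · obtain ⟨j, hj⟩ := not_forall_not.1 h0
      obtain _ | n := n
      · exact j.elim0
      have hs0 : s 0 = 0 := le_antisymm (hj ▸ hs.monotone (Fin.zero_le j)) (Fin.zero_le _)
      have hpos : ∀ j, Fin.tail s j ≠ 0 := fun j => (hs0.symm.trans_lt (hs j.succ_pos)).ne'
      obtain ⟨t, ht, hts⟩ :=
        exists_strictMono_succ_comp_eq (s := Fin.tail s) (hs.comp Fin.strictMono_succ) hpos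
      have hcons : ∀ (i : I) (k : Fin m → I),
          (Fin.cons i k : Fin (m + 1) → I) ∘ s = Fin.cons i (k ∘ t) := fun i k => by
        rw [← Fin.cons_self_tail s, hs0, ← hts]
        funext j
        cases j using Fin.cases <;> rfl
      filter_upwards [(eventually_iterUltrafilter_succ U).1 hp] with i hi
      filter_upwards [ih ht hi] with k hk
      exact (hcons i k).symm ▸ hk

theorem tendsto_iterUltrafilter_iterLim {n : ℕ} {f : (Fin n → I) → 𝕜} {C : ℝ}
    (hf : ∀ k, ‖f k‖ ≤ C) : Tendsto f (iterUltrafilter U n) (𝓝 (iterLim U n f)) := by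
  induction n with
  | zero => exact tendsto_pure_nhds f _
  | succ n ih =>
    refine tendsto_nhds.2 fun s hs hmem => (eventually_iterUltrafilter_succ U).2 ?_
    filter_upwards [(tendsto_iterLim U n f C hf).eventually (hs.mem_nhds hmem)] with i hi
    exact (ih fun _ => hf _).eventually (hs.mem_nhds hi)

theorem iterLim_const (n : ℕ) (c : 𝕜) : iterLim U n (fun _ => c) = c :=
  tendsto_nhds_unique (tendsto_iterUltrafilter_iterLim U fun _ => le_rfl) tendsto_const_nhds

end IteratedUltrafilter

section Multilinear

variable {𝕜 : Type} [RCLike 𝕜] {I : Type u} (U : Ultrafilter I) {n : ℕ}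
variable {E : Type u} [NormedAddCommGroup E] [NormedSpace 𝕜 E]

theorem Ultrapower.exists_mk_eq {ι : Type*} (z : ι → Ultrapower 𝕜 U E) :
    ∃ w : ι → lp (fun _ : I => E) ∞, (fun j => Ultrapower.mk 𝕜 U (w j)) = z :=
  ⟨fun j => (z j).rep, funext fun j => Ultrapower.mk_rep (z j)⟩

theorem tendsto_iterExtMultilinear (A : ContinuousMultilinearMap 𝕜 (fun _ : Fin n => E) 𝕜)
    (w : Fin n → lp (fun _ : I => E) ∞) :
    Tendsto (fun k : Fin n → I => A fun j => w j (k j)) (iterUltrafilter U n)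
      (𝓝 (iterExtMultilinear A fun j => Ultrapower.mk 𝕜 U (w j))) := by
  have hbound : ∀ k : Fin n → I, ‖A fun j => w j (k j)‖ ≤ ‖A‖ * ∏ j, ‖w j‖ := fun k => by
    refine (A.le_opNorm _).trans ?_
    gcongr with j
    exact lp.norm_apply_le_norm ENNReal.top_ne_zero (w j) (k j)
  rw [iterExtMultilinear_mk]
  exact tendsto_iterUltrafilter_iterLim U hbound

theorem norm_iterExtMultilinear_le (A : ContinuousMultilinearMap 𝕜 (fun _ : Fin n => E) 𝕜)
    (z : Fin n → Ultrapower 𝕜 U E) : ‖iterExtMultilinear A z‖ ≤ ‖A‖ * ∏ j, ‖z j‖ := by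
  obtain ⟨w, rfl⟩ := Ultrapower.exists_mk_eq U z
  have hw : ∀ j, Tendsto (fun k : Fin n → I => ‖w j (k j)‖) (iterUltrafilter U n)
      (𝓝 ‖Ultrapower.mk 𝕜 U (w j)‖) := fun j =>
    (Ultrapower.tendsto_norm (w j)).comp (tendsto_apply_iterUltrafilter U j)
  exact le_of_tendsto_of_tendsto' (tendsto_iterExtMultilinear U A w).norm
    ((tendsto_finsetProd Finset.univ fun j _ => hw j).const_mul ‖A‖) fun k => A.le_opNorm _

theorem update_mk [DecidableEq (Fin n)] (w : Fin n → lp (fun _ : I => E) ∞) (j : Fin n)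
    (x : lp (fun _ : I => E) ∞) :
    Function.update (fun l => Ultrapower.mk 𝕜 U (w l)) j (Ultrapower.mk 𝕜 U x) =
      fun l => Ultrapower.mk 𝕜 U (Function.update w j x l) :=
  (Function.comp_update (Ultrapower.mk 𝕜 U) w j x).symm

theorem update_family_apply [DecidableEq (Fin n)] (w : Fin n → lp (fun _ : I => E) ∞) (j : Fin n)
    (x : lp (fun _ : I => E) ∞) (k : Fin n → I) :
    (fun l => (Function.update w j x l : I → E) (k l)) =
      Function.update (fun l => w l (k l)) j (x (k j)) :=
  funext (Function.apply_update (fun l (y : lp (fun _ : I => E) ∞) => y (k l)) w j x)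

/-- `iterExtMultilinear A` as a continuous multilinear form on the ultrapower. -/
def iterExtCMM (A : ContinuousMultilinearMap 𝕜 (fun _ : Fin n => E) 𝕜) :
    ContinuousMultilinearMap 𝕜 (fun _ : Fin n => Ultrapower 𝕜 U E) 𝕜 :=
  MultilinearMap.mkContinuous
    { toFun := iterExtMultilinear A
      map_update_add' := by
        intro _ z j x y
        obtain ⟨w, rfl⟩ := Ultrapower.exists_mk_eq U z
        obtain ⟨x, rfl⟩ := Ultrapower.mk_surjective x
        obtain ⟨y, rfl⟩ := Ultrapower.mk_surjective y
        simp only [← map_add, update_mk]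
        refine tendsto_nhds_unique (tendsto_iterExtMultilinear U A _)
          (((tendsto_iterExtMultilinear U A _).add (tendsto_iterExtMultilinear U A _)).congr
            fun k => ?_)
        simp only [update_family_apply, lp.coeFn_add, Pi.add_apply, A.map_update_add]
      map_update_smul' := by
        intro _ z j c x
        obtain ⟨w, rfl⟩ := Ultrapower.exists_mk_eq U z
        obtain ⟨x, rfl⟩ := Ultrapower.mk_surjective x
        simp only [← map_smul, update_mk]
        refine tendsto_nhds_unique (tendsto_iterExtMultilinear U A _)
          (((tendsto_iterExtMultilinear U A _).const_smul c).congr fun k => ?_)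
        simp only [update_family_apply, lp.coeFn_smul, Pi.smul_apply, A.map_update_smul] }
    ‖A‖ (norm_iterExtMultilinear_le U A)

theorem diag_mem_homPoly (A : ContinuousMultilinearMap 𝕜 (fun _ : Fin n => E) 𝕜) :
    (fun x => A fun _ => x) ∈ HomPoly 𝕜 n E := by
  refine ⟨(n.factorial : 𝕜)⁻¹ • ∑ σ : Equiv.Perm (Fin n), A.domDomCongr σ, fun τ v => ?_,
    fun x => ?_⟩
  · simp only [smul_apply, sum_apply, ContinuousMultilinearMap.domDomCongr_apply]
    exact congrArg _
      (Equiv.sum_comp (Equiv.mulLeft τ) fun σ : Equiv.Perm (Fin n) => A fun i => v (σ i))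
  · simp [Finset.card_univ, Fintype.card_perm, Nat.factorial_ne_zero]

theorem iterExt_mem_homPoly (P : HomPoly 𝕜 n E) :
    iterExt U P ∈ HomPoly 𝕜 n (Ultrapower 𝕜 U E) :=
  diag_mem_homPoly (iterExtCMM U (HomPoly.assoc P))

end Multilinear

section Embedding

variable (𝕜 : Type) [RCLike 𝕜] {I : Type u} (U : Ultrafilter I) {n : ℕ}
variable (E : Type u) [NormedAddCommGroup E] [NormedSpace 𝕜 E]

/-- The constant family `(x)_{i ∈ I}` as a bounded family, linearly in `x`. -/
def constFamily : E →ₗ[𝕜] lp (fun _ : I => E) ∞ where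
  toFun x := ⟨fun _ => x, memℓp_infty ⟨‖x‖, Set.forall_mem_range.2 fun _ => le_rfl⟩⟩
  map_add' _ _ := rfl
  map_smul' _ _ := rfl

/-- The canonical embedding of `E` into its ultrapower. -/
def canonicalEmbedding : E →L[𝕜] Ultrapower 𝕜 U E :=
  (Ultrapower.mk 𝕜 U ∘ₗ constFamily 𝕜 E).mkContinuous 1 fun x => by
    rw [one_mul]
    exact le_of_tendsto' (Ultrapower.tendsto_norm (constFamily 𝕜 E x)) fun _ => le_rfl

theorem norm_canonicalEmbedding_le : ‖canonicalEmbedding 𝕜 U E‖ ≤ 1 :=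
  LinearMap.mkContinuous_norm_le _ zero_le_one _

variable {𝕜 E}

theorem iterExt_comp_canonicalEmbedding (P : HomPoly 𝕜 n E) :
    iterExt U P ∘ canonicalEmbedding 𝕜 U E = P.1 := by
  funext x
  rw [HomPoly.assoc_diag P]
  exact (iterExtMultilinear_mk (HomPoly.assoc P) fun _ => constFamily 𝕜 E x).trans
    (iterLim_const U n (HomPoly.assoc P fun _ => x))

end Embedding

section Average

theorem card_filter_injective (α β : Type*) [Fintype α] [Fintype β] [DecidableEq α]
    [DecidableEq β] : (Finset.univ.filter fun s : α → β => Function.Injective s).card =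
      (Fintype.card β).descFactorial (Fintype.card α) := by
  rw [← Fintype.card_subtype, Fintype.card_congr (Equiv.subtypeInjectiveEquivEmbedding α β),
    Fintype.card_embedding_eq]

theorem card_filter_not_injective (m n : ℕ) :
    ((Finset.univ.filter fun s : Fin n → Fin m => ¬ Function.Injective s).card : ℝ) =
      (m : ℝ) ^ n - m.descFactorial n := by
  have hsum := Finset.card_filter_add_card_filter_not (s := (Finset.univ : Finset (Fin n → Fin m)))
    fun s : Fin n → Fin m => Function.Injective s
  rw [card_filter_injective, Finset.card_univ, Fintype.card_fun, Fintype.card_fin,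
    Fintype.card_fin] at hsum
  rw [eq_sub_iff_add_eq']
  exact_mod_cast hsum

theorem tendsto_proportion_not_injective (n : ℕ) :
    Tendsto (fun m : ℕ => (m : ℝ)⁻¹ ^ n *
      ((Finset.univ.filter fun s : Fin n → Fin m => ¬ Function.Injective s).card : ℝ))
      atTop (𝓝 0) := by
  have hdesc : Tendsto (fun m : ℕ => (m.descFactorial n : ℝ) / (m : ℝ) ^ n) atTop (𝓝 1) := by
    refine (Asymptotics.isEquivalent_iff_tendsto_one ?_).1 (isEquivalent_descFactorial n)
    filter_upwards [eventually_ne_atTop 0] with m hm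
    exact pow_ne_zero n (Nat.cast_ne_zero.2 hm)
  refine (sub_self (1 : ℝ) ▸ hdesc.const_sub 1).congr' ?_
  filter_upwards [eventually_ne_atTop 0] with m hm
  rw [card_filter_not_injective, inv_pow]
  field_simp

variable {𝕜 : Type} [RCLike 𝕜] {I : Type u} {m n : ℕ}
variable {E : Type u} [NormedAddCommGroup E] [NormedSpace 𝕜 E]

theorem norm_inv_smul_sum_le {V : Type*} [NormedAddCommGroup V] [NormedSpace 𝕜 V] {v : Fin m → V}
    {r : ℝ} (hr : 0 ≤ r) (hv : ∀ j, ‖v j‖ ≤ r) : ‖(m : 𝕜)⁻¹ • ∑ j, v j‖ ≤ r := by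
  have hsum : ‖∑ j, v j‖ ≤ m * r := by
    simpa using norm_sum_le_of_le Finset.univ fun j _ => hv j
  rw [norm_smul, norm_inv, RCLike.norm_natCast]
  exact inv_mul_le_of_le_mul₀ m.cast_nonneg hr hsum

theorem map_diag_smul_sum (A : ContinuousMultilinearMap 𝕜 (fun _ : Fin n => E) 𝕜) (c : 𝕜)
    (v : Fin m → E) :
    A (fun _ => c • ∑ j, v j) = c ^ n * ∑ s : Fin n → Fin m, A fun l => v (s l) := by
  rw [A.map_smul_univ (fun _ => c) fun _ => ∑ j, v j, A.map_sum]
  simp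

variable (𝕜 E) in
/-- The operator `w ↦ (w_{k₁} + ⋯ + w_{kₘ}) / m` on bounded families; it is `0` for `m = 0`. -/
def familyAverage (k : Fin m → I) : lp (fun _ : I => E) ∞ →L[𝕜] E :=
  (m : 𝕜)⁻¹ • ∑ j, lp.evalCLM 𝕜 (fun _ : I => E) ∞ (k j)

theorem familyAverage_apply (k : Fin m → I) (w : lp (fun _ : I => E) ∞) :
    familyAverage 𝕜 E k w = (m : 𝕜)⁻¹ • ∑ j, w (k j) := by
  simp [familyAverage, sum_apply, lp.evalCLM]

theorem norm_familyAverage_apply_le (k : Fin m → I) (w : lp (fun _ : I => E) ∞) :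
    ‖familyAverage 𝕜 E k w‖ ≤ ‖w‖ := by
  rw [familyAverage_apply]
  exact norm_inv_smul_sum_le (norm_nonneg w) fun j =>
    lp.norm_apply_le_norm ENNReal.top_ne_zero w (k j)

theorem norm_familyAverage_comp_le {N : Type*} [NormedAddCommGroup N] [NormedSpace 𝕜 N]
    (G : N →L[𝕜] lp (fun _ : I => E) ∞) {k : Fin m → I} {r : ℝ} (hr : 0 ≤ r)
    (hk : ∀ j, ‖(lp.evalCLM 𝕜 (fun _ : I => E) ∞ (k j)).comp G‖ ≤ r) :
    ‖(familyAverage 𝕜 E k).comp G‖ ≤ r := by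
  rw [familyAverage, ContinuousLinearMap.smul_comp, ContinuousLinearMap.finsetSum_comp]
  exact norm_inv_smul_sum_le hr hk

variable (U : Ultrafilter I)

theorem tendsto_apply_comp_injective {A : ContinuousMultilinearMap 𝕜 (fun _ : Fin n => E) 𝕜}
    (hA : ∀ (σ : Equiv.Perm (Fin n)) (v : Fin n → E), A (v ∘ σ) = A v)
    (w : lp (fun _ : I => E) ∞) {s : Fin n → Fin m} (hs : Function.Injective s) :
    Tendsto (fun k : Fin m → I => A fun l => w (k (s l))) (iterUltrafilter U m)
      (𝓝 (iterExtMultilinear A fun _ => Ultrapower.mk 𝕜 U w)) := by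
  have hmono : StrictMono (s ∘ Tuple.sort s) :=
    (Tuple.monotone_sort s).strictMono_of_injective (hs.comp (Tuple.sort s).injective)
  refine ((tendsto_iterExtMultilinear U A fun _ => w).comp
    (tendsto_comp_iterUltrafilter U hmono)).congr fun k => ?_
  exact hA (Tuple.sort s) fun l => w (k (s l))

theorem norm_map_le_mul_pow (A : ContinuousMultilinearMap 𝕜 (fun _ : Fin n => E) 𝕜)
    {v : Fin n → E} {b : ℝ} (hb : 0 ≤ b) (hv : ∀ l, ‖v l‖ ≤ b) : ‖A v‖ ≤ ‖A‖ * b ^ n := by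
  simpa using A.le_opNorm_mul_pow_of_le ((pi_norm_le_iff_of_nonneg hb).2 hv)

theorem tendsto_iterLim_familyAverage (A : ContinuousMultilinearMap 𝕜 (fun _ : Fin n => E) 𝕜)
    (m : ℕ) (w : lp (fun _ : I => E) ∞) :
    Tendsto (fun k : Fin m → I => A fun _ => familyAverage 𝕜 E k w) (iterUltrafilter U m)
      (𝓝 (iterLim U m fun k => A fun _ => familyAverage 𝕜 E k w)) :=
  tendsto_iterUltrafilter_iterLim U fun k =>
    norm_map_le_mul_pow A (norm_nonneg w) fun _ => norm_familyAverage_apply_le k w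

theorem norm_iterLim_familyAverage_sub_le
    {A : ContinuousMultilinearMap 𝕜 (fun _ : Fin n => E) 𝕜}
    (hA : ∀ (σ : Equiv.Perm (Fin n)) (v : Fin n → E), A (v ∘ σ) = A v) (hm : m ≠ 0)
    (w : lp (fun _ : I => E) ∞) :
    ‖(iterLim U m fun k => A fun _ => familyAverage 𝕜 E k w) -
        iterExtMultilinear A fun _ => Ultrapower.mk 𝕜 U w‖ ≤
      (m : ℝ)⁻¹ ^ n *
        ((Finset.univ.filter fun s : Fin n → Fin m => ¬ Function.Injective s).card : ℝ) *
        (2 * (‖A‖ * ‖w‖ ^ n)) := by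
  set L := iterExtMultilinear A fun _ => Ultrapower.mk 𝕜 U w
  set B := ‖A‖ * ‖w‖ ^ n
  let a (s : Fin n → Fin m) (k : Fin m → I) : 𝕜 := A fun l => w (k (s l))
  have ha : ∀ s k, ‖a s k‖ ≤ B := fun s k =>
    norm_map_le_mul_pow A (norm_nonneg w) fun l =>
      lp.norm_apply_le_norm ENNReal.top_ne_zero w (k (s l))
  have hL : ‖L‖ ≤ B :=
    le_of_tendsto' (tendsto_iterExtMultilinear U A fun _ => w).norm fun k =>
      norm_map_le_mul_pow A (norm_nonneg w) fun l =>
        lp.norm_apply_le_norm ENNReal.top_ne_zero w (k l)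
  have hexpand : ∀ k, (A fun _ => familyAverage 𝕜 E k w) - L =
      (m : 𝕜)⁻¹ ^ n * ∑ s, (a s k - L) := fun k => by
    have hm' : (m : 𝕜) ≠ 0 := Nat.cast_ne_zero.2 hm
    simp only [familyAverage_apply, map_diag_smul_sum, Finset.sum_sub_distrib, Finset.sum_const,
      Finset.card_univ, Fintype.card_fun, Fintype.card_fin, nsmul_eq_mul, Nat.cast_pow]
    rw [mul_sub, ← mul_assoc, ← mul_pow, inv_mul_cancel₀ hm', one_pow, one_mul]
  have hinj : Tendsto (fun k => ∑ s with Function.Injective s, (a s k - L)) (iterUltrafilter U m)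
      (𝓝 0) := by
    have hterm : ∀ s : Fin n → Fin m, Function.Injective s →
        Tendsto (fun k => a s k - L) (iterUltrafilter U m) (𝓝 0) := fun s hs =>
      sub_self L ▸ (tendsto_apply_comp_injective U hA w hs).sub_const L
    simpa only [Finset.sum_const_zero] using
      tendsto_finsetSum _ fun s hs => hterm s (Finset.mem_filter.1 hs).2
  have hninj : ∀ k, ‖∑ s with ¬ Function.Injective s, (a s k - L)‖ ≤
      (Finset.univ.filter fun s : Fin n → Fin m => ¬ Function.Injective s).card * (2 * B) :=
    fun k => by
      rw [two_mul, ← nsmul_eq_mul]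
      exact norm_sum_le_of_le _ (fun s _ => (norm_sub_le _ _).trans (add_le_add (ha s k) hL))
        |>.trans_eq (Finset.sum_const _)
  refine le_of_tendsto_of_tendsto' ((tendsto_iterLim_familyAverage U A m w).sub_const L).norm
    (by simpa only [norm_zero, zero_add, mul_assoc] using
      (hinj.norm.add_const _).const_mul ((m : ℝ)⁻¹ ^ n)) fun k => ?_
  rw [hexpand, norm_mul, norm_pow, norm_inv, RCLike.norm_natCast,
    ← Finset.sum_filter_add_sum_filter_not Finset.univ Function.Injective]
  gcongr
  exact (norm_add_le _ _).trans (add_le_add_right (hninj k) _)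

theorem tendsto_iterLim_familyAverage_iterExt (P : HomPoly 𝕜 n E) (w : lp (fun _ : I => E) ∞) :
    Tendsto (fun m => iterLim U m fun k => HomPoly.assoc P fun _ => familyAverage 𝕜 E k w) atTop
      (𝓝 (iterExt U P (Ultrapower.mk 𝕜 U w))) := by
  rw [tendsto_iff_norm_sub_tendsto_zero]
  refine squeeze_zero' (Eventually.of_forall fun _ => norm_nonneg _) ?_
    (zero_mul (2 * (‖HomPoly.assoc P‖ * ‖w‖ ^ n)) ▸
      (tendsto_proportion_not_injective n).mul_const _)
  filter_upwards [eventually_ne_atTop 0] with m hm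
  exact norm_iterLim_familyAverage_sub_le U (HomPoly.assoc_symm P) hm w

end Average

section FiniteRepresentability

variable {𝕜 : Type} [RCLike 𝕜]

/-- A function `f` on `F` is finitely representable in a function `p` on `E` if on each finite
dimensional subspace of `F`, for each `r > 1`, it is a pointwise limit of functions `p ∘ S` with
operators `S` into `E` of norm at most `r`. The closure is that of the product topology. -/
def IsFinitelyRepresentable {E F : Type*} [NormedAddCommGroup E] [NormedSpace 𝕜 E]
    [NormedAddCommGroup F] [NormedSpace 𝕜 F] (f : F → 𝕜) (p : E → 𝕜) : Prop :=
  ∀ (M : Submodule 𝕜 F) [FiniteDimensional 𝕜 M] (r : ℝ), 1 < r →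
    f ∘ M.subtypeL ∈ closure {g : M → 𝕜 | ∃ S : M →L[𝕜] E, ‖S‖ ≤ r ∧ g = p ∘ S}

theorem IsFinitelyRepresentable.apply_le {E F : Type*} [NormedAddCommGroup E] [NormedSpace 𝕜 E]
    [NormedAddCommGroup F] [NormedSpace 𝕜 F] {f : F → 𝕜} {p : E → 𝕜}
    (h : IsFinitelyRepresentable f p) (M : Submodule 𝕜 F) [FiniteDimensional 𝕜 M] {β : Type*}
    [LinearOrder β] [TopologicalSpace β] [OrderClosedTopology β] {Φ : (M → 𝕜) → β}
    (hΦ : LowerSemicontinuous Φ) {b : ℝ → β} (hb : ContinuousAt b 1)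
    (hΦb : ∀ (r : ℝ) (S : M →L[𝕜] E), ‖S‖ ≤ r → Φ (p ∘ S) ≤ b r) :
    Φ (f ∘ M.subtypeL) ≤ b 1 := by
  have hle : ∀ r : ℝ, 1 < r → Φ (f ∘ M.subtypeL) ≤ b r := fun r hr =>
    closure_minimal (by rintro _ ⟨S, hS, rfl⟩; exact hΦb r S hS) (hΦ.isClosed_preimage (b r))
      (h M r hr)
  exact ge_of_tendsto (hb.tendsto.mono_left nhdsWithin_le_nhds)
    (eventually_mem_nhdsWithin.mono hle : ∀ᶠ r in 𝓝[>] (1 : ℝ), Φ (f ∘ M.subtypeL) ≤ b r)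

variable {I : Type u} (U : Ultrafilter I) {E : Type u} [NormedAddCommGroup E] [NormedSpace 𝕜 E]
variable {N : Type*} [NormedAddCommGroup N] [NormedSpace 𝕜 N] [FiniteDimensional 𝕜 N]

theorem Ultrapower.exists_lift (J : N →L[𝕜] Ultrapower 𝕜 U E) :
    ∃ G : N →L[𝕜] lp (fun _ : I => E) ∞, ∀ x, Ultrapower.mk 𝕜 U (G x) = J x := by
  obtain ⟨g, hg⟩ := Module.projective_lifting_property (Ultrapower.mk 𝕜 U) J.toLinearMap
    Ultrapower.mk_surjective
  exact ⟨LinearMap.toContinuousLinearMap g, LinearMap.congr_fun hg⟩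

theorem eventually_opNorm_le {T : I → N →L[𝕜] E} {C a r : ℝ} (hC : ∀ i, ‖T i‖ ≤ C)
    (ha : ∀ x, ‖x‖ ≤ 1 → ∀ᶠ i in U, ‖T i x‖ ≤ a) (har : a < r) : ∀ᶠ i in U, ‖T i‖ ≤ r := by
  have hexists : ∀ i, ∃ x : N, ‖x‖ ≤ 1 ∧ (r < ‖T i‖ → r < ‖T i x‖) := fun i => by
    by_cases hi : r < ‖T i‖
    · obtain ⟨x, hx, hrx⟩ := (T i).exists_lt_apply_of_lt_opNorm hi
      exact ⟨x, hx.le, fun _ => hrx⟩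
    · exact ⟨0, by simp, fun h => absurd h hi⟩
  choose x hx hxr using hexists
  have : ProperSpace N := FiniteDimensional.proper 𝕜 N
  obtain ⟨y, hy, hxy⟩ := (isCompact_closedBall (0 : N) 1).ultrafilter_le_nhds (U.map x)
    (le_principal_iff.2 (Filter.mem_map.2
      (Filter.univ_mem' fun i => mem_closedBall_zero_iff.2 (hx i))))
  have hlim : Tendsto (fun i => a + C * ‖x i - y‖) U (𝓝 a) := by
    simpa using ((tendsto_iff_norm_sub_tendsto_zero.1 hxy).const_mul C).const_add a
  filter_upwards [ha y (mem_closedBall_zero_iff.1 hy), hlim.eventually_lt_const har] with i hi hir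
  by_contra! hlt
  refine (hxr i hlt).not_ge (le_trans ?_ hir.le)
  calc ‖T i (x i)‖ = ‖T i y + T i (x i - y)‖ := by rw [← map_add, add_sub_cancel]
    _ ≤ a + C * ‖x i - y‖ := norm_add_le_of_le hi ((T i).le_of_opNorm_le (hC i) _)

theorem Ultrapower.eventually_norm_evalCLM_comp_le {G : N →L[𝕜] lp (fun _ : I => E) ∞}
    (hG : ∀ x, ‖Ultrapower.mk 𝕜 U (G x)‖ ≤ ‖x‖) {r : ℝ} (hr : 1 < r) :
    ∀ᶠ i in U, ‖(lp.evalCLM 𝕜 (fun _ : I => E) ∞ i).comp G‖ ≤ r := by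
  obtain ⟨a, ha, har⟩ := exists_between hr
  refine eventually_opNorm_le U (C := ‖G‖) (a := a) (fun i => ?_) (fun x hx => ?_) har
  · exact ContinuousLinearMap.opNorm_le_bound _ (norm_nonneg G) fun x =>
      (lp.norm_apply_le_norm ENNReal.top_ne_zero (G x) i).trans (G.le_opNorm x)
  · exact ((Ultrapower.tendsto_norm (G x)).eventually_lt_const
      (((hG x).trans hx).trans_lt ha)).mono fun _ => le_of_lt

theorem iterExt_isFinitelyRepresentable {n : ℕ} (P : HomPoly 𝕜 n E) :
    IsFinitelyRepresentable (iterExt U P) P.1 := by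
  intro M _ r hr
  obtain ⟨G, hG⟩ := Ultrapower.exists_lift U M.subtypeL
  have hnorm : ∀ m, ∀ᶠ k : Fin m → I in iterUltrafilter U m,
      ‖(familyAverage 𝕜 E k).comp G‖ ≤ r := fun m => by
    have heval := Ultrapower.eventually_norm_evalCLM_comp_le U
      (fun x => (congrArg norm (hG x)).le) hr
    have hall : ∀ᶠ k : Fin m → I in iterUltrafilter U m,
        ∀ j, ‖(lp.evalCLM 𝕜 (fun _ : I => E) ∞ (k j)).comp G‖ ≤ r :=
      eventually_all.2 fun j => (tendsto_apply_iterUltrafilter U j).eventually heval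
    exact hall.mono fun k hk => norm_familyAverage_comp_le G (zero_le_one.trans hr.le) hk
  have hlim : ∀ m, Tendsto (fun k : Fin m → I => P.1 ∘ (familyAverage 𝕜 E k).comp G)
      (iterUltrafilter U m)
      (𝓝 fun x => iterLim U m fun k => HomPoly.assoc P fun _ => familyAverage 𝕜 E k (G x)) :=
    fun m => tendsto_pi_nhds.2 fun x =>
      (tendsto_iterLim_familyAverage U (HomPoly.assoc P) m (G x)).congr fun k =>
        (HomPoly.assoc_diag P _).symm
  have hlim' : Tendsto (fun m (x : M) => iterLim U m fun k => HomPoly.assoc P fun _ =>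
      familyAverage 𝕜 E k (G x)) atTop (𝓝 (iterExt U P ∘ M.subtypeL)) :=
    tendsto_pi_nhds.2 fun x => by
      simpa only [hG, Function.comp_apply] using tendsto_iterLim_familyAverage_iterExt U P (G x)
  exact isClosed_closure.mem_of_tendsto hlim' (Eventually.of_forall fun m =>
    isClosed_closure.mem_of_tendsto (hlim m) ((hnorm m).mono fun k hk =>
      subset_closure ⟨_, hk, rfl⟩))

end FiniteRepresentability

section TensorNorm

variable {𝕜 : Type} [RCLike 𝕜] {n : ℕ}

section Space

variable {E : Type u} [NormedAddCommGroup E] [NormedSpace 𝕜 E]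

theorem SymTensor.map_symPow {F : Type u} [NormedAddCommGroup F] [NormedSpace 𝕜 F] (T : E →L[𝕜] F)
    (x : E) : SymTensor.map T (symPow 𝕜 n x) = symPow 𝕜 n (T x) :=
  Subtype.ext (PiTensorProduct.map_tprod _ _)

theorem span_range_symPow :
    Submodule.span 𝕜 (Set.range (symPow 𝕜 n : E → SymTensor 𝕜 n E)) = ⊤ := by
  refine Submodule.map_injective_of_injective (SymTensor 𝕜 n E).injective_subtype ?_
  rw [Submodule.map_span, ← Set.range_comp, Submodule.map_top, Submodule.range_subtype]
  rfl

theorem SymTensor.hom_ext {V : Type*} [AddCommGroup V] [Module 𝕜 V]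
    {f g : SymTensor 𝕜 n E →ₗ[𝕜] V} (h : ∀ x, f (symPow 𝕜 n x) = g (symPow 𝕜 n x)) : f = g :=
  LinearMap.ext_on_range span_range_symPow h

/-- Continuity is for pointwise convergence on `E`, so that bounds at `z` survive pointwise
limits of polynomials. -/
theorem SymTensor.exists_eval (z : SymTensor 𝕜 n E) :
    ∃ ev : (E → 𝕜) →L[𝕜] 𝕜, ∀ L : SymTensor 𝕜 n E →ₗ[𝕜] 𝕜,
      ev (fun x => L (symPow 𝕜 n x)) = L z := by
  obtain ⟨c, rfl⟩ := Finsupp.mem_span_range_iff_exists_finsupp.1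
    (span_range_symPow (𝕜 := 𝕜) (n := n) (E := E) ▸ Submodule.mem_top (x := z))
  refine ⟨∑ x ∈ c.support, c x • ContinuousLinearMap.proj (R := 𝕜) (φ := fun _ : E => 𝕜) x,
    fun L => ?_⟩
  simp [Finsupp.sum, sum_apply]

/-- The linear functional on `⊗^{n,s} E` with `⊗ⁿ x ↦ A (x, …, x)`. -/
def linearization (A : ContinuousMultilinearMap 𝕜 (fun _ : Fin n => E) 𝕜) :
    SymTensor 𝕜 n E →ₗ[𝕜] 𝕜 :=
  PiTensorProduct.lift A.toMultilinearMap ∘ₗ (SymTensor 𝕜 n E).subtype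

theorem linearization_symPow (A : ContinuousMultilinearMap 𝕜 (fun _ : Fin n => E) 𝕜) (x : E) :
    linearization A (symPow 𝕜 n x) = A fun _ => x :=
  PiTensorProduct.lift.tprod _

end Space

namespace STensorNorm

variable (α : STensorNorm.{u} 𝕜 n)
variable {E F : Type u} [NormedAddCommGroup E] [NormedSpace 𝕜 E] [CompleteSpace E]
variable [NormedAddCommGroup F] [NormedSpace 𝕜 F]

/-- The restriction of a functional on `⊗̃_α^{n,s} E` to `⊗^{n,s} E`. -/
def restrict (φ : StrongDual 𝕜 (α.Compl E)) : SymTensor 𝕜 n E →ₗ[𝕜] 𝕜 :=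
  (φ.comp UniformSpace.Completion.toComplL).toLinearMap ∘ₗ α.toSpace

theorem norm_restrict_le (φ : StrongDual 𝕜 (α.Compl E)) (z : SymTensor 𝕜 n E) :
    ‖α.restrict φ z‖ ≤ ‖φ‖ * α.nrm E z :=
  (φ.le_opNorm _).trans_eq
    (congrArg (‖φ‖ * ·) (UniformSpace.Completion.norm_coe (α.toSpace z)))

theorem opNorm_le_of_restrict {φ : StrongDual 𝕜 (α.Compl E)} {C : ℝ} (hC : 0 ≤ C)
    (h : ∀ z, ‖α.restrict φ z‖ ≤ C * α.nrm E z) : ‖φ‖ ≤ C := by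
  refine φ.opNorm_le_bound hC fun x => ?_
  induction x using UniformSpace.Completion.induction_on with
  | hp => exact isClosed_le (by fun_prop) (by fun_prop)
  | ih z =>
    rw [UniformSpace.Completion.norm_coe]
    exact h z

theorem exists_restrict_eq (L : SymTensor 𝕜 n E →ₗ[𝕜] 𝕜) (C : ℝ)
    (h : ∀ z, ‖L z‖ ≤ C * α.nrm E z) : ∃ ψ : StrongDual 𝕜 (α.Compl E), α.restrict ψ = L := by
  let L' : α.Space E →L[𝕜] 𝕜 :=
    LinearMap.mkContinuous (show α.Space E →ₗ[𝕜] 𝕜 from L) C h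
  refine ⟨L'.extend UniformSpace.Completion.toComplL, LinearMap.ext fun z => ?_⟩
  exact ContinuousLinearMap.extend_eq L' (UniformSpace.Completion.denseRange_coe)
    (UniformSpace.Completion.isUniformInducing_coe _) _

theorem restrict_symPow {φ : StrongDual 𝕜 (α.Compl E)} {p : E → 𝕜} (h : α.Represents φ p) (x : E) :
    α.restrict φ (symPow 𝕜 n x) = p x := h x

variable {α}

theorem IsFinitelyGenerated.le_mul_nrm (hα : α.IsFinitelyGenerated) {a C : ℝ}
    (z : SymTensor 𝕜 n E)
    (h : ∀ (M : Submodule 𝕜 E) [FiniteDimensional 𝕜 M] (w : SymTensor 𝕜 n M),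
      SymTensor.map M.subtypeL w = z → a ≤ C * α.nrm M w) : a ≤ C * α.nrm E z := by
  have hclosed : IsClosed {t : ℝ | a ≤ C * t} := isClosed_le continuous_const (by fun_prop)
  refine closure_minimal ?_ hclosed ((hα E z).mem_closure (hα E z).nonempty)
  rintro _ ⟨M, _, w, hw, rfl⟩
  exact h M w hw

theorem norm_map_subtypeL_le {f : F → 𝕜} {p : E → 𝕜} (hfp : IsFinitelyRepresentable f p)
    {φ : StrongDual 𝕜 (α.Compl E)} (hφ : α.Represents φ p) {L : SymTensor 𝕜 n F →ₗ[𝕜] 𝕜}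
    (hL : ∀ x, L (symPow 𝕜 n x) = f x) (M : Submodule 𝕜 F) [FiniteDimensional 𝕜 M]
    (w : SymTensor 𝕜 n M) : ‖L (SymTensor.map M.subtypeL w)‖ ≤ ‖φ‖ * α.nrm M w := by
  obtain ⟨ev, hev⟩ := SymTensor.exists_eval w
  have hevf : ev (f ∘ M.subtypeL) = L (SymTensor.map M.subtypeL w) := by
    rw [← LinearMap.comp_apply, ← hev]
    congr 1
    funext x
    rw [LinearMap.comp_apply, SymTensor.map_symPow, hL, Function.comp_apply]
  have hevp : ∀ S : M →L[𝕜] E, ev (p ∘ S) = α.restrict φ (SymTensor.map S w) := fun S => by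
    rw [← LinearMap.comp_apply, ← hev]
    congr 1
    funext x
    rw [LinearMap.comp_apply, SymTensor.map_symPow, α.restrict_symPow hφ, Function.comp_apply]
  have hle := hfp.apply_le M (ev.continuous.norm.lowerSemicontinuous)
    (b := fun r => ‖φ‖ * (r ^ n * α.nrm M w)) (by fun_prop) fun r S hS => by
      have := apply_nonneg (α.nrm M) w
      calc ‖ev (p ∘ S)‖ ≤ ‖φ‖ * α.nrm E (SymTensor.map S w) := hevp S ▸ α.norm_restrict_le φ _
        _ ≤ ‖φ‖ * (‖S‖ ^ n * α.nrm M w) := by gcongr; exact α.map_le M E S w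
        _ ≤ ‖φ‖ * (r ^ n * α.nrm M w) := by gcongr
  simpa only [hevf, one_pow, one_mul] using hle

variable [CompleteSpace F]

theorem IsFinitelyGenerated.exists_represents (hα : α.IsFinitelyGenerated) {f : F → 𝕜}
    (hf : f ∈ HomPoly 𝕜 n F) {p : E → 𝕜} (hfp : IsFinitelyRepresentable f p)
    {φ : StrongDual 𝕜 (α.Compl E)} (hφ : α.Represents φ p) :
    ∃ ψ : StrongDual 𝕜 (α.Compl F), α.Represents ψ f ∧ ‖ψ‖ ≤ ‖φ‖ := by
  obtain ⟨A, -, hA⟩ := hf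
  have hL : ∀ x, linearization A (symPow 𝕜 n x) = f x := fun x =>
    (linearization_symPow A x).trans (hA x).symm
  have hbound : ∀ z, ‖linearization A z‖ ≤ ‖φ‖ * α.nrm F z := fun z =>
    hα.le_mul_nrm z fun M _ w hw => hw ▸ norm_map_subtypeL_le hfp hφ hL M w
  obtain ⟨ψ, hψ⟩ := α.exists_restrict_eq _ _ hbound
  refine ⟨ψ, fun x => ?_, α.opNorm_le_of_restrict (norm_nonneg φ) (hψ ▸ hbound)⟩
  exact (LinearMap.congr_fun hψ (symPow 𝕜 n x)).trans (hL x)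

theorem norm_le_of_represents_comp {f : F → 𝕜} {ψ : StrongDual 𝕜 (α.Compl F)}
    (hψ : α.Represents ψ f) (T : E →L[𝕜] F) {φ : StrongDual 𝕜 (α.Compl E)}
    (hφ : α.Represents φ (f ∘ T)) : ‖φ‖ ≤ ‖ψ‖ * ‖T‖ ^ n := by
  have hcomp : α.restrict φ = α.restrict ψ ∘ₗ SymTensor.map T :=
    SymTensor.hom_ext fun x => by
      rw [α.restrict_symPow hφ, LinearMap.comp_apply, SymTensor.map_symPow, α.restrict_symPow hψ,
        Function.comp_apply]
  refine α.opNorm_le_of_restrict (by positivity) fun z => ?_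
  calc ‖α.restrict φ z‖ = ‖α.restrict ψ (SymTensor.map T z)‖ := by rw [hcomp, LinearMap.comp_apply]
    _ ≤ ‖ψ‖ * α.nrm F (SymTensor.map T z) := α.norm_restrict_le ψ _
    _ ≤ ‖ψ‖ * (‖T‖ ^ n * α.nrm E z) := by gcongr; exact α.map_le E F T z
    _ = ‖ψ‖ * ‖T‖ ^ n * α.nrm E z := (mul_assoc _ _ _).symm

end STensorNorm

end TensorNorm

section Ideal

variable {𝕜 : Type} [RCLike 𝕜] {n : ℕ}

theorem isClosed_image_seminorm_ball {V : Type*} [AddCommGroup V] [Module 𝕜 V]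
    [FiniteDimensional 𝕜 V] (p : Seminorm 𝕜 V) (hp : ∀ v, p v = 0 → v = 0) {X : Type*}
    (f : V →ₗ[𝕜] X → 𝕜) (C : ℝ) : IsClosed (f '' {v | p v ≤ C}) := by
  let _ : NormedAddCommGroup V := AddGroupNorm.toNormedAddCommGroup
    { toFun := p
      map_zero' := map_zero p
      add_le' := map_add_le_add p
      neg' := map_neg_eq_map p
      eq_zero_of_map_eq_zero' := hp }
  let _ : NormedSpace 𝕜 V := ⟨fun c v => (map_smul_eq_mul p c v).le⟩
  have : ProperSpace V := FiniteDimensional.proper 𝕜 V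
  have hball : {v | p v ≤ C} = Metric.closedBall (0 : V) C := by
    ext v
    rw [mem_closedBall_zero_iff]
    rfl
  rw [hball]
  exact ((isCompact_closedBall (0 : V) C).image f.continuous_of_finiteDimensional).isClosed

theorem finiteDimensional_homPoly (M : Type u) [NormedAddCommGroup M] [NormedSpace 𝕜 M]
    [FiniteDimensional 𝕜 M] : FiniteDimensional 𝕜 (HomPoly 𝕜 n M) := by
  let diag : MultilinearMap 𝕜 (fun _ : Fin n => M) 𝕜 →ₗ[𝕜] M → 𝕜 :=
    { toFun := fun A x => A fun _ => x
      map_add' := fun _ _ => rfl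
      map_smul' := fun _ _ => rfl }
  refine Submodule.finiteDimensional_of_le (S₂ := LinearMap.range diag) ?_
  rintro P ⟨A, -, hA⟩
  exact ⟨A.toMultilinearMap, funext fun x => (hA x).symm⟩

namespace PolyIdeal

variable (Q : PolyIdeal.{u} 𝕜 n)
variable {E F : Type u} [NormedAddCommGroup E] [NormedSpace 𝕜 E] [CompleteSpace E]
variable [NormedAddCommGroup F] [NormedSpace 𝕜 F]

theorem extNrm_of_mem {p : E → 𝕜} (hp : p ∈ Q.carrier E) :
    Q.extNrm p = ENNReal.ofReal (Q.nrm E ⟨p, hp⟩) :=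
  dif_pos hp

theorem extNrm_le_coe_iff {p : E → 𝕜} {C : NNReal} :
    Q.extNrm p ≤ C ↔ ∃ hp : p ∈ Q.carrier E, Q.nrm E ⟨p, hp⟩ ≤ C := by
  by_cases hp : p ∈ Q.carrier E
  · simp [Q.extNrm_of_mem hp, hp, ENNReal.ofReal_le_iff_le_toReal]
  · simp [extNrm, hp]

theorem lowerSemicontinuous_extNrm (M : Type u) [NormedAddCommGroup M] [NormedSpace 𝕜 M]
    [CompleteSpace M] [FiniteDimensional 𝕜 M] :
    LowerSemicontinuous (Q.extNrm : (M → 𝕜) → ℝ≥0∞) := by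
  have := finiteDimensional_homPoly (𝕜 := 𝕜) (n := n) M
  have : FiniteDimensional 𝕜 (Q.carrier M) := Submodule.finiteDimensional_of_le (Q.le_homPoly M)
  refine lowerSemicontinuous_iff_isClosed_preimage.2 fun c => ?_
  cases c with
  | top => simp
  | coe C =>
    convert isClosed_image_seminorm_ball (Q.nrm M) (Q.eq_zero M) (Q.carrier M).subtype C using 1
    ext f
    simp [extNrm_le_coe_iff]

theorem maxNrm_le_of_isFinitelyRepresentable {f : F → 𝕜} {p : E → 𝕜}
    (hfp : IsFinitelyRepresentable f p) (hp : p ∈ Q.carrier E) :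
    Q.maxNrm f ≤ ENNReal.ofReal (Q.nrm E ⟨p, hp⟩) := by
  refine iSup₂_le fun M hM => ?_
  have hle := hfp.apply_le M (Q.lowerSemicontinuous_extNrm M)
    (b := fun r => ENNReal.ofReal (Q.nrm E ⟨p, hp⟩ * r ^ n))
    (ENNReal.continuous_ofReal.comp (by fun_prop)).continuousAt fun r S hS => by
      rw [Q.extNrm_of_mem (Q.comp_mem M E S p hp)]
      refine ENNReal.ofReal_le_ofReal ((Q.nrm_comp_le M E S p hp).trans ?_)
      have := apply_nonneg (Q.nrm E) ⟨p, hp⟩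
      gcongr
  simpa using hle

variable {Q} [CompleteSpace F]

theorem IsMaximal.exists_mem_nrm_le (hQ : Q.IsMaximal) {f : F → 𝕜} (hf : f ∈ HomPoly 𝕜 n F)
    {p : E → 𝕜} (hfp : IsFinitelyRepresentable f p) (hp : p ∈ Q.carrier E) :
    ∃ h : f ∈ Q.carrier F, Q.nrm F ⟨f, h⟩ ≤ Q.nrm E ⟨p, hp⟩ := by
  have hle := Q.maxNrm_le_of_isFinitelyRepresentable hfp hp
  obtain ⟨hmem, hnrm⟩ := hQ F f hf
  have h := hmem.2 (hle.trans_lt ENNReal.ofReal_lt_top)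
  exact ⟨h, (ENNReal.ofReal_le_ofReal_iff (apply_nonneg _ _)).1 (hnrm h ▸ hle)⟩

end PolyIdeal

end Ideal

end PolyExt

end

theorem theorem3p3 {𝕜 : Type} [RCLike 𝕜] (n : ℕ) {I : Type u} (U : Ultrafilter I)
    (E : Type u) [NormedAddCommGroup E] [NormedSpace 𝕜 E] [CompleteSpace E] :
    (∀ α : PolyExt.STensorNorm.{u} 𝕜 n, α.IsFinitelyGenerated →
      ∀ (P : PolyExt.HomPoly 𝕜 n E) (φ : StrongDual 𝕜 (α.Compl E)), α.Represents φ P.1 →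
        ∃ ψ : StrongDual 𝕜 (α.Compl (PolyExt.Ultrapower 𝕜 U E)),
          α.Represents ψ (PolyExt.iterExt U P) ∧ ‖φ‖ = ‖ψ‖) ∧
    (∀ Q : PolyExt.PolyIdeal.{u} 𝕜 n, Q.IsMaximal →
      ∀ (P : PolyExt.HomPoly 𝕜 n E) (hP : P.1 ∈ Q.carrier E),
        ∃ h : PolyExt.iterExt U P ∈ Q.carrier (PolyExt.Ultrapower 𝕜 U E),
          Q.nrm E ⟨P.1, hP⟩ =
            Q.nrm (PolyExt.Ultrapower 𝕜 U E) ⟨PolyExt.iterExt U P, h⟩) := by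
  have hrep (P : PolyExt.HomPoly 𝕜 n E) :
      PolyExt.IsFinitelyRepresentable (PolyExt.iterExt U P) P.1 :=
    PolyExt.iterExt_isFinitelyRepresentable U P
  have hcomp (P : PolyExt.HomPoly 𝕜 n E) :
      PolyExt.iterExt U P ∘ PolyExt.canonicalEmbedding 𝕜 U E = P.1 :=
    PolyExt.iterExt_comp_canonicalEmbedding U P
  have hJ : ‖PolyExt.canonicalEmbedding 𝕜 U E‖ ^ n ≤ 1 :=
    pow_le_one₀ (norm_nonneg _) (PolyExt.norm_canonicalEmbedding_le 𝕜 U E)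
  refine ⟨fun α hα P φ hφ => ?_, fun Q hQ P hP => ?_⟩
  · obtain ⟨ψ, hψ, hle⟩ := hα.exists_represents (PolyExt.iterExt_mem_homPoly U P) (hrep P) hφ
    have hge := PolyExt.STensorNorm.norm_le_of_represents_comp hψ _ ((hcomp P).symm ▸ hφ)
    exact ⟨ψ, hψ, le_antisymm (hge.trans (mul_le_of_le_one_right (norm_nonneg ψ) hJ)) hle⟩
  · obtain ⟨h, hle⟩ := hQ.exists_mem_nrm_le (PolyExt.iterExt_mem_homPoly U P) (hrep P) hP
    have hge := Q.nrm_comp_le _ _ (PolyExt.canonicalEmbedding 𝕜 U E) _ h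
    simp only [hcomp] at hge
    exact ⟨h, le_antisymm (hge.trans (mul_le_of_le_one_right (apply_nonneg _ _) hJ)) hle⟩
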